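/- **Model.** For $\delta'>-1$, let $\mathrm{PA}_1(1,\delta')$ be a single vertex $v_1$ with one self-loop. Given $\mathrm{PA}_n(1,\delta')$ on $v_1,\dots,v_n$, with $D_i(n)$ the degree of $v_i$ (a loop counts twice), $\mathrm{PA}_{n+1}(1,\delta')$ is obtained by adding a vertex $v_{n+1}$ with a single edge, whose other end is $v_{n+1}$ itself with probability $\frac{1+\delta'}{n(2+\delta')+(1+\delta')}$ and is $v_i$, $1\le i\le n$, with probability $\frac{D_i(n)+\delta'}{n(2+\delta')+(1+\delta')}$. For an integer $m\ge 1$ and real $\delta>-m$, the random multigraph $\mathrm{PA}_t(m,\delta)$ on $[t]=\{1,\dots,t\}$ is obtained from $\mathrm{PA}_{mt}(1,\delta/m)$ by contracting, for each $i=1,\dots,t$, the vertices $v_{m(i-1)+1},\dots,v_{mi}$ into one vertex $i$, retaining all loops and multiple edges. Let $D_i(t)$ denote the degree of vertex $i$ in $\mathrm{PA}_t(m,\delta)$. **Lemma.** Let $m\ge 1$ be an integer, $\delta\ge 0$ and $A>0$ be constants. Put $\gamma=\frac{1}{2+\delta/m}$, $\omega=\omega(t)=A\log\log t$ and $\kappa_o=\kappa_o(t)=(\log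 t)^{999\,\omega}$. Then $$\Pr\left(D_i(t)\ \ge\ \left(\frac{t}{\kappa_o}\right)^{\gamma}\frac{1}{\kappa_o^{2}}\ \text{ for every integer } i \text{ with } 1\le i\le \kappa_o\right)\longrightarrow 1\qquad\text{as } t\to\infty .$$ -/

import Mathlib

open Filter Topology

noncomputable section

/-- A finite multigraph with vertices labelled by natural numbers; loops and parallel edges are
allowed. -/
structure Multigraph where
  /-- the vertex set -/
  verts : Finset ℕ
  /-- the edges, as unordered pairs of end points, with multiplicity -/
  edges : Multiset (Sym2 ℕ)

namespace Multigraph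

instance : MeasurableSpace Multigraph := ⊤

/-- The degree of `v`: each edge contributes the number of its ends at `v`, so a loop counts
twice. -/
def degree (G : Multigraph) (v : ℕ) : ℕ :=
  (G.edges.map fun e => e.toMultiset.count v).sum

/-- Identify all vertices with the same image under `f`; all loops and parallel edges that arise
are retained. -/
def contract (f : ℕ → ℕ) (G : Multigraph) : Multigraph where
  verts := G.verts.image f
  edges := G.edges.map (Sym2.map f)

/-- Add the vertex `u` together with a single edge joining it to `v`. -/
def addVertex (G : Multigraph) (u v : ℕ) : Multigraph where
  verts := insert u G.verts
  edges := s(u, v) ::ₘ G.edges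

theorem degree_addVertex (G : Multigraph) (u v w : ℕ) :
    (G.addVertex u v).degree w
      = ((if w = u then 1 else 0) + (if w = v then 1 else 0)) + G.degree w := by
  have h : (s(u, v)).toMultiset = u ::ₘ v ::ₘ 0 := rfl
  simp only [degree, addVertex, Multiset.map_cons, Multiset.sum_cons, h, Multiset.count_cons,
    Multiset.count_zero]
  ring

end Multigraph

/-- Multigraphs on the vertex set `{1, …, n}` with `n` edges and no isolated vertices. All states
of the process `PA_n(1, δ)` are of this kind. -/
structure PAState (n : ℕ) where
  graph : Multigraph
  verts_eq : graph.verts = Finset.Icc 1 n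
  ends_mem : ∀ e ∈ graph.edges, ∀ v ∈ e, v ∈ Finset.Icc 1 n
  card_edges : graph.edges.card = n
  one_le_degree : ∀ v ∈ Finset.Icc 1 n, 1 ≤ graph.degree v

namespace PAState

/-- The graph without vertices. -/
def empty : PAState 0 where
  graph := ⟨∅, 0⟩
  verts_eq := by simp
  ends_mem := by simp
  card_edges := by simp
  one_le_degree := by simp

/-- Add the vertex `n + 1`, whose edge goes to `v ∈ {1, …, n + 1}` (a loop if `v = n + 1`). -/
def grow {n : ℕ} (G : PAState n) (v : Finset.Icc 1 (n + 1)) : PAState (n + 1) where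
  graph := G.graph.addVertex (n + 1) v
  verts_eq := by
    ext w
    simp only [Multigraph.addVertex, G.verts_eq, Finset.mem_insert, Finset.mem_Icc]
    omega
  ends_mem := by
    intro e he w hw
    rcases Multiset.mem_cons.1 he with rfl | he
    · rcases Sym2.mem_iff.1 hw with rfl | rfl
      · simp
      · exact v.2
    · have := Finset.mem_Icc.1 (G.ends_mem e he w hw)
      exact Finset.mem_Icc.2 ⟨this.1, by omega⟩
  card_edges := by simp [Multigraph.addVertex, G.card_edges]
  one_le_degree := by
    intro w hw
    rw [Multigraph.degree_addVertex]
    by_cases h : w = n + 1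
    · simp [h]; omega
    · have := Finset.mem_Icc.1 hw
      have := G.one_le_degree w (Finset.mem_Icc.2 ⟨this.1, by omega⟩)
      omega

theorem sum_degree {n : ℕ} (G : PAState n) :
    ∑ v ∈ Finset.Icc 1 n, G.graph.degree v = 2 * n := by
  have key : ∀ s : Multiset (Sym2 ℕ), (∀ e ∈ s, ∀ v ∈ e, v ∈ Finset.Icc 1 n) →
      ∑ v ∈ Finset.Icc 1 n, (s.map fun e => e.toMultiset.count v).sum = 2 * s.card := by
    intro s
    induction s using Multiset.induction with
    | empty => simp
    | cons e s ih =>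
      intro h
      have h1 : ∑ v ∈ Finset.Icc 1 n, e.toMultiset.count v = 2 := by
        rw [Multiset.sum_count_eq_card, Sym2.card_toMultiset]
        intro a ha
        exact h e (Multiset.mem_cons_self e s) a (Sym2.mem_toMultiset.1 ha)
      simp only [Multiset.map_cons, Multiset.sum_cons, Finset.sum_add_distrib, Multiset.card_cons]
      rw [h1, ih fun e he => h e (Multiset.mem_cons_of_mem he)]
      ring
  simpa [Multigraph.degree, G.card_edges] using key G.graph.edges G.ends_mem

/-- The probability that the edge of the new vertex `n + 1` goes to `v`, given the graph `G` on
`{1, …, n}`. -/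
def attachProb {n : ℕ} (δ : ℝ) (G : PAState n) (v : ℕ) : ℝ :=
  if v = n + 1 then (1 + δ) / (n * (2 + δ) + (1 + δ))
  else (G.graph.degree v + δ) / (n * (2 + δ) + (1 + δ))

theorem attachProb_nonneg {n : ℕ} {δ : ℝ} (hδ : -1 < δ) (G : PAState n)
    (v : Finset.Icc 1 (n + 1)) : 0 ≤ attachProb δ G v := by
  have hd : 0 ≤ (n : ℝ) * (2 + δ) + (1 + δ) :=
    add_nonneg (mul_nonneg n.cast_nonneg (by linarith)) (by linarith)
  unfold attachProb
  split_ifs with h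
  · exact div_nonneg (by linarith) hd
  · have hv := Finset.mem_Icc.1 v.2
    have h1 := G.one_le_degree v (Finset.mem_Icc.2 ⟨hv.1, by omega⟩)
    have h2 : (1 : ℝ) ≤ G.graph.degree v := by exact_mod_cast h1
    exact div_nonneg (by linarith) hd

theorem sum_attachProb {n : ℕ} {δ : ℝ} (hδ : -1 < δ) (G : PAState n) :
    ∑ v : Finset.Icc 1 (n + 1), attachProb δ G v = 1 := by
  have hd : 0 < (n : ℝ) * (2 + δ) + (1 + δ) :=
    add_pos_of_nonneg_of_pos (mul_nonneg n.cast_nonneg (by linarith)) (by linarith)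
  rw [Finset.sum_coe_sort (Finset.Icc 1 (n + 1)) (attachProb δ G),
    Finset.sum_Icc_succ_top (by omega)]
  have h1 : ∑ v ∈ Finset.Icc 1 n, attachProb δ G v
      = ∑ v ∈ Finset.Icc 1 n, ((G.graph.degree v : ℝ) + δ) / (n * (2 + δ) + (1 + δ)) := by
    refine Finset.sum_congr rfl fun v hv => ?_
    have := Finset.mem_Icc.1 hv
    rw [attachProb, if_neg (by omega)]
  have h2 : ∑ v ∈ Finset.Icc 1 n, (G.graph.degree v : ℝ) = 2 * n := by
    exact_mod_cast G.sum_degree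
  rw [h1, ← Finset.sum_div, Finset.sum_add_distrib, h2, attachProb, if_pos rfl, ← add_div]
  rw [div_eq_one_iff_eq hd.ne']
  simp
  ring

/-- The conditional law of the vertex to which the new vertex `n + 1` attaches. -/
def attach {n : ℕ} (δ : ℝ) (hδ : -1 < δ) (G : PAState n) : PMF (Finset.Icc 1 (n + 1)) :=
  PMF.ofFintype (fun v => ENNReal.ofReal (attachProb δ G v)) (by
    rw [← ENNReal.ofReal_sum_of_nonneg fun v _ => attachProb_nonneg hδ G v, sum_attachProb hδ G,
      ENNReal.ofReal_one])

end PAState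

/-- The law of `PA_n(1, δ)`, for `δ > -1`. Since `attachProb δ empty 1 = 1`, the graph
`PA_1(1, δ)` is a single vertex with one loop. -/
def PAOne (δ : ℝ) (hδ : -1 < δ) : (n : ℕ) → PMF (PAState n)
  | 0 => PMF.pure PAState.empty
  | n + 1 => (PAOne δ hδ n).bind fun G => (G.attach δ hδ).map G.grow

theorem neg_one_lt_div {m : ℕ} (hm : 0 < m) {δ : ℝ} (hδ : -(m : ℝ) < δ) : -1 < δ / m := by
  rw [lt_div_iff₀ (by exact_mod_cast hm)]
  linarith

/-- The law of `PA_t(m, δ)`, for `m ≥ 1` and `δ > -m`: in `PA_{mt}(1, δ/m)` the vertices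
`m (i - 1) + 1, …, m i` are contracted to the vertex `i`, for each `i = 1, …, t`. -/
def PA (m : ℕ) (hm : 0 < m) (δ : ℝ) (hδ : -(m : ℝ) < δ) (t : ℕ) : PMF Multigraph :=
  (PAOne (δ / m) (neg_one_lt_div hm hδ) (m * t)).map
    fun G => G.graph.contract fun j => (j - 1) / m + 1

/-- `γ = 1 / (2 + δ / m)` -/
def paGamma (m : ℕ) (δ : ℝ) : ℝ := 1 / (2 + δ / m)

/-- `ω = A log log t` -/
def omegaRadius (A : ℝ) (t : ℕ) : ℝ := A * Real.log (Real.log t)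

/-- `κ_o = (log t)^(999 ω)` -/
def kappaOuter (A : ℝ) (t : ℕ) : ℝ := Real.log t ^ (999 * omegaRadius A t)

/-- The outer core `[κ_o] = {1, …, ⌊κ_o⌋}`. -/
def outerCore (A : ℝ) (t : ℕ) : Set ℕ := {i | 1 ≤ i ∧ (i : ℝ) ≤ kappaOuter A t}

end

/-! A negative fractional moment controls the lower tail of a degree. When a vertex has degree `d`,
it gains an edge with probability `(d + δ) / Z`, where `Z` is the normaliser, and `degreeWeight s`
is then multiplied by `1 - s / d`. For `δ ≥ 0` the mean of the weight thus shrinks by a factor of at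
most `1 - s / Z`, whatever `d` is (`sum_attachProb_mul_degreeWeight_le`). Multiplying these factors
gives decay like `(w / n) ^ (s γ)` (`tsum_PAOne_mul_degreeWeight_le`).

The weight is at least `(1 - s) d ^ (-s)`, so Markov's inequality bounds the probability of a degree
below `x` by a constant times `x ^ s (w / n) ^ (s γ)`. At the threshold of the theorem the powers of
`t / κ` cancel and `κ ^ (-2 s)` remains. A union bound over at most `κ` vertices succeeds as soon as
`2 s > 1`; here `s = 3 / 4`. -/

namespace Multigraph

/-- Every edge end at `v` becomes an end at `f v`, so one vertex of each block suffices for a lower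
bound. -/
theorem degree_le_degree_contract (f : ℕ → ℕ) (G : Multigraph) (v : ℕ) :
    G.degree v ≤ (G.contract f).degree (f v) := by
  simp only [degree, contract, Multiset.map_map]
  refine Multiset.sum_map_le_sum_map _ _ fun e _ => ?_
  induction e with
  | _ a b =>
    have h : ∀ x y : ℕ, (s(x, y)).toMultiset = x ::ₘ y ::ₘ 0 := fun _ _ => rfl
    simp only [Function.comp_apply, Sym2.map_mk, h, Multiset.count_cons, Multiset.count_zero]
    by_cases hb : v = b <;> by_cases ha : v = a <;> simp [ha, hb] <;> grind

end Multigraph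

namespace PMF

theorem tsum_bind_mul {α β : Type*} (p : PMF α) (g : α → PMF β) (h : β → ENNReal) :
    ∑' b, p.bind g b * h b = ∑' a, p a * ∑' b, g a b * h b := by
  simp only [bind_apply, ← ENNReal.tsum_mul_right, ← ENNReal.tsum_mul_left, mul_assoc]
  exact ENNReal.tsum_comm

theorem tsum_map_mul {α β : Type*} (p : PMF α) (g : α → β) (h : β → ENNReal) :
    ∑' b, p.map g b * h b = ∑' a, p a * h (g a) := by
  rw [← bind_pure_comp, tsum_bind_mul]
  refine tsum_congr fun a => ?_
  rw [tsum_eq_single (g a)]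
  · simp
  · intro b hb
    simp [pure_apply, hb]

/-- Markov's inequality. -/
theorem toOuterMeasure_le_tsum_mul {α : Type*} (p : PMF α) (s : Set α) (h : α → ENNReal)
    (hs : ∀ a ∈ s, 1 ≤ h a) : p.toOuterMeasure s ≤ ∑' a, p a * h a := by
  rw [toOuterMeasure_apply]
  refine ENNReal.tsum_le_tsum fun a => ?_
  by_cases ha : a ∈ s
  · simpa [ha] using mul_le_mul_right (hs a ha) (p a)
  · simp [ha]

end PMF

/-- The product `∏_{1 ≤ k < d} (1 - s / k)`, which is of order `d ^ (-s)`. Its mean along the degree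
of a vertex of `PA_n(1, δ)` decays like a power of `n`. -/
noncomputable def degreeWeight (s : ℝ) (d : ℕ) : ℝ := ∏ k ∈ Finset.Ico 1 d, (1 - s / k)

/-! ### Comparison of the weight with a power of the degree. -/

section degreeWeight

variable {s : ℝ}

theorem degreeWeight_succ {d : ℕ} (hd : 1 ≤ d) :
    degreeWeight s (d + 1) = degreeWeight s d * (1 - s / d) :=
  Finset.prod_Ico_succ_top hd _

theorem degreeWeight_factor_mem (hs0 : 0 ≤ s) (hs1 : s ≤ 1) {k : ℕ} (hk : 1 ≤ k) :
    0 ≤ 1 - s / k ∧ 1 - s / k ≤ 1 := by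
  have hk' : (1 : ℝ) ≤ k := by exact_mod_cast hk
  have : s / k ≤ 1 := by rw [div_le_one (by linarith)]; linarith
  have : 0 ≤ s / k := by positivity
  constructor <;> linarith

theorem degreeWeight_nonneg (hs0 : 0 ≤ s) (hs1 : s ≤ 1) (d : ℕ) : 0 ≤ degreeWeight s d :=
  Finset.prod_nonneg fun _ hk => (degreeWeight_factor_mem hs0 hs1 (Finset.mem_Ico.1 hk).1).1

theorem degreeWeight_le_one (hs0 : 0 ≤ s) (hs1 : s ≤ 1) (d : ℕ) : degreeWeight s d ≤ 1 :=
  Finset.prod_le_one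
    (fun _ hk => (degreeWeight_factor_mem hs0 hs1 (Finset.mem_Ico.1 hk).1).1)
    fun _ hk => (degreeWeight_factor_mem hs0 hs1 (Finset.mem_Ico.1 hk).1).2

/-- The factor at `k = 1` is the constant `1 - s`. For `k ≥ 2`, Bernoulli's inequality with exponent
`s ≤ 1` gives `1 - s / k ≥ ((k - 1) / k) ^ s`, and these bounds telescope. -/
theorem mul_rpow_neg_le_degreeWeight_add_two (hs0 : 0 ≤ s) (hs1 : s ≤ 1) (d : ℕ) :
    (1 - s) * ((d : ℝ) + 1) ^ (-s) ≤ degreeWeight s (d + 2) := by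
  induction d with
  | zero => simp [degreeWeight]
  | succ d ih =>
    rw [degreeWeight_succ (by omega)]
    have hd : (0 : ℝ) < d + 1 := by positivity
    have hd2 : (0 : ℝ) < d + 2 := by positivity
    have hB : (((d : ℝ) + 1) / (d + 2)) ^ s ≤ 1 - s / (d + 2) := by
      have := rpow_one_add_le_one_add_mul_self (s := -(1 / ((d : ℝ) + 2))) (p := s)
        (by rw [neg_le_neg_iff, div_le_one hd2]; linarith) hs0 hs1
      convert this using 1
      · congr 1; field_simp; ring
      · ring
    have hB' : (((d : ℝ) + 2)) ^ (-s) ≤ ((d : ℝ) + 1) ^ (-s) * (1 - s / (d + 2)) := by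
      rw [Real.div_rpow hd.le hd2.le] at hB
      rw [Real.rpow_neg hd2.le, Real.rpow_neg hd.le]
      have h1 : 0 < ((d : ℝ) + 1) ^ s := Real.rpow_pos_of_pos hd s
      rw [inv_mul_eq_div, le_div_iff₀ h1, inv_mul_eq_div]
      exact hB
    have hpos := degreeWeight_factor_mem hs0 hs1 (k := d + 2) (by omega)
    push_cast at hpos ⊢
    calc (1 - s) * ((d : ℝ) + 1 + 1) ^ (-s)
        = (1 - s) * ((d : ℝ) + 2) ^ (-s) := by ring_nf
      _ ≤ (1 - s) * (((d : ℝ) + 1) ^ (-s) * (1 - s / (d + 2))) :=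
          mul_le_mul_of_nonneg_left hB' (by linarith)
      _ = ((1 - s) * ((d : ℝ) + 1) ^ (-s)) * (1 - s / (d + 2)) := by ring
      _ ≤ degreeWeight s (d + 2) * (1 - s / (d + 2)) := mul_le_mul_of_nonneg_right ih hpos.1

theorem mul_rpow_neg_le_degreeWeight (hs0 : 0 ≤ s) (hs1 : s ≤ 1) {d : ℕ} (hd : 1 ≤ d) :
    (1 - s) * (d : ℝ) ^ (-s) ≤ degreeWeight s d := by
  rcases Nat.lt_or_ge d 2 with h | h
  · obtain rfl : d = 1 := by omega
    simp [degreeWeight, hs0]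
  · obtain ⟨e, rfl⟩ := Nat.exists_eq_add_of_le' h
    refine le_trans ?_ (mul_rpow_neg_le_degreeWeight_add_two hs0 hs1 e)
    refine mul_le_mul_of_nonneg_left ?_ (by linarith)
    refine Real.rpow_le_rpow_of_nonpos (by positivity) ?_ (by linarith)
    push_cast; linarith

end degreeWeight

/-! ### Decay of the mean weight and the resulting degree tails. -/

namespace PAState

theorem degree_grow {n : ℕ} (G : PAState n) (v : Finset.Icc 1 (n + 1)) {w : ℕ} (hw : w ≤ n) :
    (G.grow v).graph.degree w = (if w = v then 1 else 0) + G.graph.degree w := by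
  have h : w ≠ n + 1 := by omega
  simp [grow, Multigraph.degree_addVertex, h]

theorem sum_attachProb_mul_degreeWeight_le {n : ℕ} {δ s : ℝ} (hδ : 0 ≤ δ) (hs0 : 0 ≤ s)
    (hs1 : s ≤ 1) (G : PAState n) {w : ℕ} (hw : w ∈ Finset.Icc 1 n) :
    ∑ v : Finset.Icc 1 (n + 1), attachProb δ G v * degreeWeight s ((G.grow v).graph.degree w)
      ≤ (1 - s / (n * (2 + δ) + (1 + δ))) * degreeWeight s (G.graph.degree w) := by
  have hw' := Finset.mem_Icc.1 hw
  set d := G.graph.degree w with hd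
  have hd1 : 1 ≤ d := G.one_le_degree w hw
  have hd1' : (1 : ℝ) ≤ d := by exact_mod_cast hd1
  set Z : ℝ := n * (2 + δ) + (1 + δ) with hZ
  have hZ0 : 0 < Z := by positivity
  have hF := degreeWeight_nonneg hs0 hs1 d
  have h1 : ∀ v : Finset.Icc 1 (n + 1),
      attachProb δ G v * degreeWeight s ((G.grow v).graph.degree w)
        = attachProb δ G v * degreeWeight s d
          + if (⟨w, by simp; omega⟩ : Finset.Icc 1 (n + 1)) = v then
              attachProb δ G v * (degreeWeight s (d + 1) - degreeWeight s d) else 0 := by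
    intro v
    rw [degree_grow G v hw'.2]
    by_cases h : w = v
    · rw [if_pos h, if_pos (Subtype.ext h), add_comm 1]; ring
    · rw [if_neg h, if_neg (fun h' => h (congrArg Subtype.val h')), zero_add, add_zero]
  rw [Finset.sum_congr rfl fun v _ => h1 v, Finset.sum_add_distrib, ← Finset.sum_mul,
    sum_attachProb (by linarith) G, Finset.sum_ite_eq, if_pos (Finset.mem_univ _), attachProb,
    if_neg (by simp only; omega), degreeWeight_succ hd1]
  -- Only here does the sign of `δ` enter the drift: `(d + δ) / d ≥ 1`.
  have h2 : s ≤ (d + δ) * (s / d) := by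
    rw [mul_div_assoc', le_div_iff₀ (by linarith)]; nlinarith
  have h3 : s / Z ≤ (d + δ) / Z * (s / d) := by
    rw [div_mul_eq_mul_div]; gcongr
  simp only [← hd, ← hZ]
  nlinarith [mul_le_mul_of_nonneg_right h3 hF]

theorem tsum_attach_mul_degreeWeight_le {n : ℕ} {δ s : ℝ} (hδ' : -1 < δ) (hδ : 0 ≤ δ)
    (hs0 : 0 ≤ s) (hs1 : s ≤ 1) (G : PAState n) {w : ℕ} (hw : w ∈ Finset.Icc 1 n) :
    ∑' v, G.attach δ hδ' v * ENNReal.ofReal (degreeWeight s ((G.grow v).graph.degree w))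
      ≤ ENNReal.ofReal (1 - s / (n * (2 + δ) + (1 + δ)))
        * ENNReal.ofReal (degreeWeight s (G.graph.degree w)) := by
  rw [tsum_fintype, ← ENNReal.ofReal_mul' (degreeWeight_nonneg hs0 hs1 _)]
  simp only [attach, PMF.ofFintype_apply]
  rw [Finset.sum_congr rfl fun v _ => (ENNReal.ofReal_mul (attachProb_nonneg hδ' G v)).symm,
    ← ENNReal.ofReal_sum_of_nonneg fun v _ =>
      mul_nonneg (attachProb_nonneg hδ' G v) (degreeWeight_nonneg hs0 hs1 _)]
  exact ENNReal.ofReal_le_ofReal (sum_attachProb_mul_degreeWeight_le hδ hs0 hs1 G hw)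

end PAState

/-- The normaliser is `(n + 1) (2 + δ) - 1`, so the left side is at most `1 - p / (n + 1)` with `p =
s / (2 + δ)`. Bernoulli bounds the reciprocal of the right side by `1 + p / (n + 1)`, and the
product of the two is at most 1. The right sides telescope over `n`. -/
theorem one_sub_div_le_rpow {n : ℕ} {δ s : ℝ} (hδ : 0 ≤ δ) (hs0 : 0 ≤ s) (hs1 : s ≤ 1) :
    1 - s / (n * (2 + δ) + (1 + δ))
      ≤ (((n : ℝ) + 1) / (n + 2)) ^ (s * (1 / (2 + δ))) := by
  have hn : (0 : ℝ) < n + 1 := by positivity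
  have hn2 : (0 : ℝ) < n + 2 := by positivity
  set p := s * (1 / (2 + δ)) with hp
  have hp0 : 0 ≤ p := by positivity
  have hp1 : p ≤ 1 := mul_le_one₀ hs1 (by positivity) (by rw [div_le_one] <;> linarith)
  have h1 : p / (n + 1) ≤ s / (n * (2 + δ) + (1 + δ)) := by
    rw [hp, mul_one_div, div_div]
    gcongr
    linarith
  have h2 : (((n : ℝ) + 2) / (n + 1)) ^ p ≤ 1 + p / (n + 1) := by
    have := rpow_one_add_le_one_add_mul_self (s := 1 / ((n : ℝ) + 1)) (p := p)
      (by have : 0 < 1 / ((n : ℝ) + 1) := by positivity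
          linarith) hp0 hp1
    convert this using 1
    · congr 1; field_simp; ring
    · ring
  have h3 : 0 < (((n : ℝ) + 2) / (n + 1)) ^ p := by positivity
  rw [← inv_div ((n : ℝ) + 2), Real.inv_rpow (by positivity), ← one_div, le_div_iff₀ h3]
  have h4 : 0 ≤ p / (n + 1) := by positivity
  by_cases h5 : 0 ≤ 1 - s / (n * (2 + δ) + (1 + δ))
  · calc _ ≤ (1 - s / (n * (2 + δ) + (1 + δ))) * (1 + p / (n + 1)) := by gcongr
      _ ≤ (1 - p / (n + 1)) * (1 + p / (n + 1)) := by gcongr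
      _ ≤ 1 := by nlinarith
  · nlinarith

/-- Decay of a negative fractional moment of the degree of the vertex `w`. -/
theorem tsum_PAOne_mul_degreeWeight_le {δ s : ℝ} (hδ' : -1 < δ) (hδ : 0 ≤ δ) (hs0 : 0 ≤ s)
    (hs1 : s ≤ 1) {w : ℕ} (hw : 1 ≤ w) {n : ℕ} (hn : w ≤ n) :
    ∑' G, PAOne δ hδ' n G * ENNReal.ofReal (degreeWeight s (G.graph.degree w))
      ≤ ENNReal.ofReal ((((w : ℝ) + 1) / (n + 1)) ^ (s * (1 / (2 + δ)))) := by
  induction n, hn using Nat.le_induction with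
  | base =>
    rw [div_self (by positivity), Real.one_rpow, ENNReal.ofReal_one,
      ← (PAOne δ hδ' w).tsum_coe]
    refine ENNReal.tsum_le_tsum fun G => mul_le_of_le_one_right' ?_
    rw [← ENNReal.ofReal_one]
    exact ENNReal.ofReal_le_ofReal (degreeWeight_le_one hs0 hs1 _)
  | succ n hn ih =>
    rw [PAOne, PMF.tsum_bind_mul]
    simp only [PMF.tsum_map_mul]
    calc _ ≤ ∑' G, PAOne δ hδ' n G * (ENNReal.ofReal (1 - s / (n * (2 + δ) + (1 + δ)))
              * ENNReal.ofReal (degreeWeight s (G.graph.degree w))) := by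
            gcongr with G
            exact G.tsum_attach_mul_degreeWeight_le hδ' hδ hs0 hs1 (Finset.mem_Icc.2 ⟨hw, hn⟩)
      _ = ENNReal.ofReal (1 - s / (n * (2 + δ) + (1 + δ)))
            * ∑' G, PAOne δ hδ' n G * ENNReal.ofReal (degreeWeight s (G.graph.degree w)) := by
            rw [← ENNReal.tsum_mul_left]
            exact tsum_congr fun G => mul_left_comm _ _ _
      _ ≤ ENNReal.ofReal ((((n : ℝ) + 1) / (n + 2)) ^ (s * (1 / (2 + δ))))
            * ENNReal.ofReal ((((w : ℝ) + 1) / (n + 1)) ^ (s * (1 / (2 + δ)))) :=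
            mul_le_mul' (ENNReal.ofReal_le_ofReal (one_sub_div_le_rpow hδ hs0 hs1)) ih
      _ = _ := by
            rw [← ENNReal.ofReal_mul (by positivity),
              ← Real.mul_rpow (by positivity) (by positivity)]
            congr 2
            push_cast
            field_simp
            ring

/-- The lower tail of the degree of a vertex of `PA_n(1, δ)`. -/
theorem PAOne_toOuterMeasure_degree_lt_le {δ s : ℝ} (hδ' : -1 < δ) (hδ : 0 ≤ δ) (hs0 : 0 ≤ s)
    (hs1 : s < 1) {w : ℕ} (hw : 1 ≤ w) {n : ℕ} (hn : w ≤ n) {x : ℝ} (hx : 0 < x) :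
    (PAOne δ hδ' n).toOuterMeasure {G | (G.graph.degree w : ℝ) < x}
      ≤ ENNReal.ofReal ((1 - s)⁻¹ * x ^ s * (((w : ℝ) + 1) / (n + 1)) ^ (s * (1 / (2 + δ)))) := by
  have hc : 0 ≤ (1 - s)⁻¹ * x ^ s :=
    mul_nonneg (inv_nonneg.2 (by linarith)) (Real.rpow_nonneg hx.le s)
  refine (PMF.toOuterMeasure_le_tsum_mul _ _
    -- The constant is the reciprocal of `(1 - s) x ^ (-s)`, a lower bound for the weight on the
    -- event.
    (fun G => ENNReal.ofReal ((1 - s)⁻¹ * x ^ s)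
      * ENNReal.ofReal (degreeWeight s (G.graph.degree w))) ?_).trans ?_
  · intro G hG
    have hd := G.one_le_degree w (Finset.mem_Icc.2 ⟨hw, hn⟩)
    have hd0 : (0 : ℝ) < G.graph.degree w := by exact_mod_cast hd
    rw [← ENNReal.ofReal_mul hc, ← ENNReal.ofReal_one]
    refine ENNReal.ofReal_le_ofReal ?_
    have h1 := mul_rpow_neg_le_degreeWeight hs0 hs1.le hd
    have h2 : x ^ (-s) ≤ (G.graph.degree w : ℝ) ^ (-s) :=
      Real.rpow_le_rpow_of_nonpos hd0 (le_of_lt hG) (by linarith)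
    have h3 : (1 - s) * x ^ (-s) ≤ degreeWeight s (G.graph.degree w) :=
      (mul_le_mul_of_nonneg_left h2 (by linarith)).trans h1
    refine le_trans (le_of_eq ?_) (mul_le_mul_of_nonneg_left h3 hc)
    have h4 : x ^ s ≠ 0 := (Real.rpow_pos_of_pos hx s).ne'
    have h5 : 1 - s ≠ 0 := by linarith
    rw [Real.rpow_neg hx.le]
    field_simp
  · rw [ENNReal.ofReal_mul hc]
    refine le_trans (le_of_eq ?_)
      (mul_le_mul_right (tsum_PAOne_mul_degreeWeight_le hδ' hδ hs0 hs1.le hw hn) _)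
    rw [← ENNReal.tsum_mul_left]
    exact tsum_congr fun G => mul_left_comm _ _ _

/-- The lower tail of the degree of a vertex of `PA_t(m, δ)`. -/
theorem PA_toMeasure_degree_lt_le {m : ℕ} (hm : 0 < m) {δ : ℝ} (hδ : -(m : ℝ) < δ) (hδ0 : 0 ≤ δ)
    {s : ℝ} (hs0 : 0 ≤ s) (hs1 : s < 1) {i t : ℕ} (hi : 1 ≤ i) (hit : i ≤ t) {x : ℝ}
    (hx : 0 < x) :
    (PA m hm δ hδ t).toMeasure {G | (G.degree i : ℝ) < x}
      ≤ ENNReal.ofReal ((1 - s)⁻¹ * x ^ s * (2 * (i : ℝ) / t) ^ (s * paGamma m δ)) := by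
  have hw : m * (i - 1) + 1 ≤ m * i := by
    obtain ⟨j, rfl⟩ := Nat.exists_eq_add_of_le' hi
    simp only [Nat.add_sub_cancel]; nlinarith
  have hmt : m * i ≤ m * t := Nat.mul_le_mul_left m hit
  have hm' : (0 : ℝ) < m := by exact_mod_cast hm
  have ht : (0 : ℝ) < t := by exact_mod_cast (show 0 < t by omega)
  have hδm : 0 ≤ δ / m := by positivity
  rw [PMF.toMeasure_apply_eq_toOuterMeasure_apply _ MeasurableSpace.measurableSet_top, PA,
    PMF.toOuterMeasure_map_apply]
  -- The first vertex of block `i`, namely `m (i - 1) + 1`, represents the whole block.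
  have hsub : (fun G : PAState (m * t) => G.graph.contract fun j => (j - 1) / m + 1) ⁻¹'
      {G | (G.degree i : ℝ) < x} ⊆ {G | (G.graph.degree (m * (i - 1) + 1) : ℝ) < x} := by
    intro G hG
    have hG' : ((G.graph.contract fun j => (j - 1) / m + 1).degree i : ℝ) < x := hG
    refine lt_of_le_of_lt (Nat.cast_le.2 ?_) hG'
    have := G.graph.degree_le_degree_contract (fun j => (j - 1) / m + 1) (m * (i - 1) + 1)
    simpa [Nat.mul_div_cancel_left _ hm, Nat.sub_add_cancel hi] using this
  refine (MeasureTheory.measure_mono hsub).trans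
    ((PAOne_toOuterMeasure_degree_lt_le (neg_one_lt_div hm hδ) hδm hs0 hs1 (by omega)
      (hw.trans hmt) hx).trans (ENNReal.ofReal_le_ofReal ?_))
  refine mul_le_mul_of_nonneg_left ?_
    (mul_nonneg (inv_nonneg.2 (by linarith)) (Real.rpow_nonneg hx.le s))
  refine Real.rpow_le_rpow (by positivity) ?_ (by positivity)
  have h1 : ((m * (i - 1) + 1 : ℕ) : ℝ) + 1 ≤ 2 * (m * i) := by
    have : 1 ≤ m * i := by omega
    exact_mod_cast (show m * (i - 1) + 1 + 1 ≤ 2 * (m * i) by omega)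
  calc (((m * (i - 1) + 1 : ℕ) : ℝ) + 1) / ((m * t : ℕ) + 1) ≤ 2 * (m * i) / (m * t) := by
        push_cast at h1 ⊢
        gcongr
        linarith
    _ = 2 * i / t := by field_simp

/-! ### Growth of `κ_o`: only `κ_o → ∞` and eventually `κ_o ≤ t` matter. -/

theorem kappaOuter_eventuallyEq (A : ℝ) :
    kappaOuter A =ᶠ[atTop] fun t => Real.exp (999 * A * Real.log (Real.log t) ^ 2) := by
  have h : Tendsto (fun t : ℕ => Real.log t) atTop atTop :=
    Real.tendsto_log_atTop.comp tendsto_natCast_atTop_atTop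
  filter_upwards [h.eventually_gt_atTop 0] with t ht
  rw [kappaOuter, omegaRadius, Real.rpow_def_of_pos ht]
  ring_nf

theorem tendsto_kappaOuter {A : ℝ} (hA : 0 < A) : Tendsto (kappaOuter A) atTop atTop := by
  have h : Tendsto (fun t : ℕ => Real.log (Real.log t)) atTop atTop :=
    Real.tendsto_log_atTop.comp (Real.tendsto_log_atTop.comp tendsto_natCast_atTop_atTop)
  refine Tendsto.congr' (kappaOuter_eventuallyEq A).symm (Real.tendsto_exp_atTop.comp ?_)
  exact ((tendsto_pow_atTop two_ne_zero).comp h).const_mul_atTop (by positivity)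

/-- Holds because `(log log t) ^ 2 = o(log t)`; it ensures that all core vertices exist at time `t`.
-/
theorem eventually_kappaOuter_le (A : ℝ) : ∀ᶠ t : ℕ in atTop, kappaOuter A t ≤ t := by
  have h : Tendsto (fun t : ℕ => Real.log t) atTop atTop :=
    Real.tendsto_log_atTop.comp tendsto_natCast_atTop_atTop
  have hlog : (fun x : ℝ => 999 * A * Real.log x ^ 2) =o[atTop] fun x => x :=
    (Real.isLittleO_pow_log_id_atTop (n := 2)).const_mul_left (999 * A)
  have hb := h.eventually (hlog.bound one_pos)
  filter_upwards [kappaOuter_eventuallyEq A, hb, h.eventually_gt_atTop 0,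
    eventually_gt_atTop 0] with t h1 h2 h3 h4
  have ht : (0 : ℝ) < t := by exact_mod_cast h4
  rw [h1, ← Real.le_log_iff_exp_le ht]
  refine (le_abs_self _).trans ?_
  simpa [abs_of_pos h3] using h2

/-! ### Union bound over the core and conclusion. -/

theorem PA_toMeasure_exists_degree_lt_le {m : ℕ} (hm : 0 < m) {δ : ℝ} (hδ : -(m : ℝ) < δ)
    (hδ0 : 0 ≤ δ) {t : ℕ} {κ : ℝ} (hκ : 1 ≤ κ) (hκt : κ ≤ t) :
    (PA m hm δ hδ t).toMeasure
        {G | ∃ i : ℕ, (1 ≤ i ∧ (i : ℝ) ≤ κ) ∧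
          (G.degree i : ℝ) < ((t : ℝ) / κ) ^ paGamma m δ / κ ^ 2}
      ≤ ENNReal.ofReal (8 * κ ^ (-(1 / 2) : ℝ)) := by
  have hκ0 : 0 < κ := by linarith
  have ht : (0 : ℝ) < t := by linarith
  have hm' : (0 : ℝ) < m := by exact_mod_cast hm
  set g := paGamma m δ with hg
  have hg0 : 0 ≤ g := by rw [hg, paGamma]; positivity
  have hg1 : g ≤ 1 := by
    have : 0 ≤ δ / m := by positivity
    rw [hg, paGamma, div_le_one] <;> linarith
  set x := ((t : ℝ) / κ) ^ g / κ ^ 2 with hx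
  have hx0 : 0 < x := by positivity
  have hbound : ∀ i ∈ Finset.Icc 1 ⌊κ⌋₊,
      (PA m hm δ hδ t).toMeasure {G | (G.degree i : ℝ) < x}
        ≤ ENNReal.ofReal (8 * κ ^ (-(3 / 2) : ℝ)) := by
    intro i hi
    rw [Finset.mem_Icc] at hi
    have hiκ : (i : ℝ) ≤ κ := (Nat.le_floor_iff hκ0.le).1 hi.2
    have hit : i ≤ t := by exact_mod_cast hiκ.trans hκt
    -- Any `s` in `(1 / 2, 1)` would do. In the bound, `8 = 4 * 2`: the 4 is `(1 - s)⁻¹`, and the 2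
    -- bounds `2 ^ (s γ)`.
    refine (PA_toMeasure_degree_lt_le hm hδ hδ0 (s := 3 / 4) (by norm_num) (by norm_num) hi.1 hit
      hx0).trans (ENNReal.ofReal_le_ofReal ?_)
    rw [← hg]
    have h1 : (2 * (i : ℝ) / t) ^ (3 / 4 * g) ≤ 2 * (κ / t) ^ (3 / 4 * g) := by
      calc (2 * (i : ℝ) / t) ^ (3 / 4 * g) ≤ (2 * (κ / t)) ^ (3 / 4 * g) := by
            rw [← mul_div_assoc]; gcongr
        _ = 2 ^ (3 / 4 * g) * (κ / t) ^ (3 / 4 * g) :=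
            Real.mul_rpow (by norm_num) (by positivity)
        _ ≤ 2 ^ (1 : ℝ) * (κ / t) ^ (3 / 4 * g) := by
            gcongr
            · norm_num
            · linarith
        _ = _ := by rw [Real.rpow_one]
    -- The first factor cancels the power of `κ / t` in `h1`; the second comes from the `κ ^ 2` in
    -- the threshold.
    have h2 : x ^ (3 / 4 : ℝ) = ((κ / t) ^ (3 / 4 * g))⁻¹ * κ ^ (-(3 / 2) : ℝ) := by
      rw [hx, Real.div_rpow (by positivity) (by positivity), ← Real.rpow_mul (by positivity),
        ← Real.rpow_natCast, ← Real.rpow_mul hκ0.le, ← Real.inv_rpow (by positivity), inv_div,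
        Real.rpow_neg hκ0.le, mul_comm g, ← div_eq_mul_inv]
      norm_num
    have h3 : 0 < (κ / t) ^ (3 / 4 * g) := by positivity
    calc _ ≤ (1 - 3 / 4 : ℝ)⁻¹ * x ^ (3 / 4 : ℝ) * (2 * (κ / t) ^ (3 / 4 * g)) := by
          gcongr
      _ = 8 * κ ^ (-(3 / 2) : ℝ) := by
          rw [h2]; field_simp; norm_num
  have hsub : {G : Multigraph | ∃ i : ℕ, (1 ≤ i ∧ (i : ℝ) ≤ κ) ∧ (G.degree i : ℝ) < x}
      ⊆ ⋃ i ∈ Finset.Icc 1 ⌊κ⌋₊, {G | (G.degree i : ℝ) < x} := by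
    rintro G ⟨i, ⟨hi1, hi2⟩, hi⟩
    exact Set.mem_biUnion (Finset.mem_coe.2 (Finset.mem_Icc.2 ⟨hi1, Nat.le_floor hi2⟩)) hi
  refine (MeasureTheory.measure_mono hsub).trans
    ((MeasureTheory.measure_biUnion_finset_le _ _).trans ((Finset.sum_le_sum hbound).trans ?_))
  rw [Finset.sum_const, Nat.card_Icc, Nat.add_sub_cancel, nsmul_eq_mul,
    ← ENNReal.ofReal_natCast, ← ENNReal.ofReal_mul (by positivity)]
  refine ENNReal.ofReal_le_ofReal ?_
  calc (⌊κ⌋₊ : ℝ) * (8 * κ ^ (-(3 / 2) : ℝ)) ≤ κ * (8 * κ ^ (-(3 / 2) : ℝ)) := by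
        gcongr; exact Nat.floor_le hκ0.le
    _ = 8 * (κ ^ (1 : ℝ) * κ ^ (-(3 / 2) : ℝ)) := by rw [Real.rpow_one]; ring
    _ = 8 * κ ^ (-(1 / 2) : ℝ) := by rw [← Real.rpow_add hκ0]; norm_num

theorem mainTheorem5 (m : ℕ) (hm : 0 < m) (δ : ℝ) (hδ : -(m : ℝ) < δ) (hδ0 : 0 ≤ δ)
    (A : ℝ) (hA : 0 < A) :
    Tendsto
      (fun t : ℕ => (PA m hm δ hδ t).toMeasure
        {G | ∀ i ∈ outerCore A t,
          ((t : ℝ) / kappaOuter A t) ^ paGamma m δ / kappaOuter A t ^ 2 ≤ (G.degree i : ℝ)})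
      atTop (𝓝 1) := by
  have hlim : Tendsto (fun t => 1 - ENNReal.ofReal (8 * kappaOuter A t ^ (-(1 / 2) : ℝ))) atTop
      (𝓝 1) := by
    have h1 : Tendsto (fun t => 8 * kappaOuter A t ^ (-(1 / 2) : ℝ)) atTop (𝓝 0) := by
      simpa using
        ((tendsto_rpow_neg_atTop one_half_pos).comp (tendsto_kappaOuter hA)).const_mul (8 : ℝ)
    simpa using ENNReal.Tendsto.sub tendsto_const_nhds (ENNReal.tendsto_ofReal h1)
      (Or.inl ENNReal.one_ne_top)
  refine tendsto_of_tendsto_of_tendsto_of_le_of_le' hlim tendsto_const_nhds ?_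
    (Eventually.of_forall fun t => MeasureTheory.prob_le_one)
  filter_upwards [(tendsto_kappaOuter hA).eventually_ge_atTop 1, eventually_kappaOuter_le A]
    with t h1 h2
  rw [tsub_le_iff_left, ← MeasureTheory.prob_add_prob_compl (μ := (PA m hm δ hδ t).toMeasure)
    (MeasurableSpace.measurableSet_top (s := {G : Multigraph | ∀ i ∈ outerCore A t,
      ((t : ℝ) / kappaOuter A t) ^ paGamma m δ / kappaOuter A t ^ 2 ≤ (G.degree i : ℝ)})), add_comm]
  gcongr
  refine le_trans (le_of_eq ?_) (PA_toMeasure_exists_degree_lt_le hm hδ hδ0 h1 h2)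
  congr 1
  ext G
  simp [outerCore, and_assoc]
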